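/- For an $N\times N$ complex matrix $R$ let $\langle R\rangle:=N^{-1}\operatorname{Tr}R$, $\mathring R:=R-\langle R\rangle$, $\Im R:=(R-R^*)/(2\mathrm i)$, and let $\|R\|$ be the operator norm induced by the Euclidean norm. For Hermitian $N\times N$ matrices $A,B$, $x\in\mathbb R$ and $z\in\mathbb C\setminus\mathbb R$ let $M^x(z)$ be the unique $N\times N$ matrix solving the matrix Dyson equation $$-M^{-1}=z-B-xA+\langle M\rangle,\qquad (\Im M)(\Im z)>0,$$ and for $E\in\mathbb R$ set $$\rho^x(E):=\lim_{\eta\to0^+}\tfrac1\pi\langle\Im M^x(E+\mathrm i\eta)\rangle,\qquad M^x(E):=\lim_{\eta\to0^+}M^x(E+\mathrm i\eta).$$ **Lemma.** For every $c_1>0$ there is $c^*>0$ such that for all $C_0,C_A,L$ there are constants $c,C>0$ (depending only on $c_1,C_0,C_A,L$, in particular not on $N$) with the following property. Let $N\in\mathbb N$, let $A,B$ be Hermitian $N\times N$ matrices with $\|B\|\le C_0$ and $\|A\|\le C_A$, and let $x_1,x_2\in[-L,L]$ and $E_1,E_2\in\mathbb R$ satisfy $|x_1-x_2|+|E_1-E_2|\le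 c^*$ and $\rho^{x_r}(E_r)\ge c_1$ for $r=1,2$. Then the limits $M^{x_r}(E_r)$, $r=1,2$, exist, and $$\bigl|1-\langle M^{x_1}(E_1)\,M^{x_2}(E_2)^{(*)}\rangle\bigr|\ \ge\ c\Bigl(|E_1-x_1\langle A\rangle-E_2+x_2\langle A\rangle|^2+|x_1-x_2|^2\langle\mathring A^2\rangle\Bigr)-C\bigl(|x_1-x_2|^3+|E_1-E_2|^3\bigr),$$ where $M^{(*)}$ means that the bound holds both for $M$ and for its adjoint $M^*$. -/

import Mathlib

open Filter Topology
open scoped ComplexStarModule ComplexOrder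

noncomputable section

namespace MDE

variable {N : ℕ}

/-- The normalized trace `⟨R⟩ = N⁻¹ Tr R`. -/
def ntr (R : Matrix (Fin N) (Fin N) ℂ) : ℂ := (N : ℂ)⁻¹ * R.trace

/-- The traceless part `R - ⟨R⟩` of `R`. -/
def traceless (R : Matrix (Fin N) (Fin N) ℂ) : Matrix (Fin N) (Fin N) ℂ :=
  R - ntr R • (1 : Matrix (Fin N) (Fin N) ℂ)

/-- The matrix norm induced by the Euclidean vector norm. -/
def opNorm (R : Matrix (Fin N) (Fin N) ℂ) : ℝ :=
  ‖Matrix.toEuclideanCLM (n := Fin N) (𝕜 := ℂ) R‖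

/-- `M` is invertible and solves the matrix Dyson equation `-M⁻¹ = z - B - xA + ⟨M⟩` subject to
`(Im M)(Im z) > 0` in the sense of positive definite matrices, where `Im M = (M - M*) / 2i`. -/
def IsSolution (B A : Matrix (Fin N) (Fin N) ℂ) (x : ℝ) (z : ℂ)
    (M : Matrix (Fin N) (Fin N) ℂ) : Prop :=
  IsUnit M ∧
  -M⁻¹ = z • (1 : Matrix (Fin N) (Fin N) ℂ) - B - (x : ℂ) • A
    + ntr M • (1 : Matrix (Fin N) (Fin N) ℂ) ∧
  (z.im • (ℑ M : Matrix (Fin N) (Fin N) ℂ)).PosDef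

open Classical in
/-- `M^x(z)`. For Hermitian `A`, `B` and non-real `z` the equation has exactly one solution, so
the default value `0` is never used there. -/
def sol (B A : Matrix (Fin N) (Fin N) ℂ) (x : ℝ) (z : ℂ) : Matrix (Fin N) (Fin N) ℂ :=
  if h : ∃ M, IsSolution B A x z M then h.choose else 0

/-- `π⁻¹ ⟨Im M^x(E + iη)⟩`. -/
def smoothedDensity (B A : Matrix (Fin N) (Fin N) ℂ) (x E η : ℝ) : ℝ :=
  Real.pi⁻¹ * (ntr (ℑ (sol B A x ((E : ℂ) + (η : ℂ) * Complex.I)) :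
    Matrix (Fin N) (Fin N) ℂ)).re

/-- The self-consistent density of states `ρ^x(E) = lim_{η → 0+} π⁻¹ ⟨Im M^x(E + iη)⟩`. -/
def scDos (B A : Matrix (Fin N) (Fin N) ℂ) (x E : ℝ) : ℝ :=
  limUnder (𝓝[>] (0 : ℝ)) (smoothedDensity B A x E)

/-- `ρ^x(E) ≥ c`, where `ρ^x(E)` is a genuine limit. -/
def IsBulk (c : ℝ) (B A : Matrix (Fin N) (Fin N) ℂ) (x E : ℝ) : Prop :=
  Tendsto (smoothedDensity B A x E) (𝓝[>] (0 : ℝ)) (𝓝 (scDos B A x E)) ∧ c ≤ scDos B A x E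

/-- The boundary value `M^x(E) = lim_{η → 0+} M^x(E + iη)` at a real energy. -/
def bdry (B A : Matrix (Fin N) (Fin N) ℂ) (x E : ℝ) : Matrix (Fin N) (Fin N) ℂ :=
  limUnder (𝓝[>] (0 : ℝ)) (fun η : ℝ => sol B A x ((E : ℂ) + (η : ℂ) * Complex.I))

/-- The limit defining `M^x(E)` exists. -/
def HasBdry (B A : Matrix (Fin N) (Fin N) ℂ) (x E : ℝ) : Prop :=
  Tendsto (fun η : ℝ => sol B A x ((E : ℂ) + (η : ℂ) * Complex.I)) (𝓝[>] (0 : ℝ))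
    (𝓝 (bdry B A x E))

/-- `|E₁ - x₁⟨A⟩ - E₂ + x₂⟨A⟩|² + |x₁ - x₂|² ⟨Å²⟩`. -/
def mainTerm (A : Matrix (Fin N) (Fin N) ℂ) (x₁ x₂ E₁ E₂ : ℝ) : ℝ :=
  ‖(E₁ : ℂ) - x₁ * ntr A - E₂ + x₂ * ntr A‖ ^ 2
    + |x₁ - x₂| ^ 2 * (ntr (traceless A ^ 2)).re

end MDE

end

open scoped Matrix.Norms.Frobenius

namespace MDE

variable {N : ℕ}

/-! ### Frobenius and operator norms -/

section Frobenius

/-! Here `‖X‖` is the Frobenius norm. For a resolvent `M = (H - ω)⁻¹`, `⟨Im M⟩ = Im ω · ‖M‖²/N`; at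
a real bulk energy `Im ω = ⟨Im M⟩ > 0`, so `‖M‖²/N = 1`. Hence `Re (1 - ⟨M₁ M₂ᴴ⟩)` is exactly half
of `‖M₁ - M₂‖²/N`.

With the adjoint, this distance dominates the main term: the inverses `M_r⁻¹` are bounded in
operator norm (`opNorm_resolvent_inv_le`), so `M₁⁻¹ - M₂⁻¹ = (x₁ - x₂)A - (ω₁ - ω₂)` is controlled
by `M₁ - M₂`, and so is the shift `⟨M₁⟩ - ⟨M₂⟩` hidden in `ω₁ - ω₂`
(`mainTerm_le_norm_resolvent_sub_sq`).

Without the adjoint, `M₁` is compared with `M₂ᴴ`: their traces lie in opposite half-planes, giving a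
gap of order one (`two_mul_sq_le_norm_one_sub_ntr_mul`), while the main term is bounded. The same
gap makes `M` Lipschitz in `η`, so boundary values exist. -/

lemma frobenius_norm_sq_eq_sum (X : Matrix (Fin N) (Fin N) ℂ) :
    ‖X‖ ^ 2 = ∑ i, ∑ j, ‖X i j‖ ^ 2 := by
  have h0 : 0 ≤ ∑ i, ∑ j, ‖X i j‖ ^ 2 := by positivity
  rw [Matrix.frobenius_norm_def, ← Real.sqrt_eq_rpow]
  simpa using Real.sq_sqrt h0

lemma frobenius_norm_sq (X : Matrix (Fin N) (Fin N) ℂ) :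
    ((‖X‖ ^ 2 : ℝ) : ℂ) = (X * X.conjTranspose).trace := by
  rw [frobenius_norm_sq_eq_sum]
  simp [Matrix.trace, Matrix.mul_apply, Complex.mul_conj']

lemma frobenius_norm_sub_sq (X Y : Matrix (Fin N) (Fin N) ℂ) :
    ‖X - Y‖ ^ 2 = ‖X‖ ^ 2 + ‖Y‖ ^ 2 - 2 * (X * Y.conjTranspose).trace.re := by
  have h : ((‖X - Y‖ ^ 2 : ℝ) : ℂ) = ((‖X‖ ^ 2 : ℝ) : ℂ) + ((‖Y‖ ^ 2 : ℝ) : ℂ)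
      - ((X * Y.conjTranspose).trace + star (X * Y.conjTranspose).trace) := by
    simp only [frobenius_norm_sq, ← Matrix.trace_conjTranspose, Matrix.conjTranspose_sub,
      Matrix.conjTranspose_mul, Matrix.conjTranspose_conjTranspose, Matrix.trace_sub, sub_mul,
      mul_sub]
    ring
  have h' := congrArg Complex.re h
  simp only [Complex.ofReal_re, Complex.sub_re, Complex.add_re, Complex.star_def,
    Complex.conj_re] at h'
  linarith

lemma frobenius_norm_one_sq : ‖(1 : Matrix (Fin N) (Fin N) ℂ)‖ ^ 2 = N := by
  have h := frobenius_norm_sq (1 : Matrix (Fin N) (Fin N) ℂ)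
  simp only [Matrix.conjTranspose_one, mul_one, Matrix.trace_one, Fintype.card_fin] at h
  exact_mod_cast h

lemma norm_trace_sq_le (X : Matrix (Fin N) (Fin N) ℂ) : ‖X.trace‖ ^ 2 ≤ N * ‖X‖ ^ 2 := by
  calc ‖X.trace‖ ^ 2 ≤ (∑ i, ‖X i i‖) ^ 2 := by
        gcongr
        exact norm_sum_le _ _
    _ ≤ N * ∑ i, ‖X i i‖ ^ 2 := by
        simpa using sq_sum_le_card_mul_sum_sq (s := Finset.univ) (f := fun i => ‖X i i‖)
    _ ≤ N * ‖X‖ ^ 2 := by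
        rw [frobenius_norm_sq_eq_sum]
        gcongr with i
        exact Finset.single_le_sum (f := fun j => ‖X i j‖ ^ 2) (fun _ _ => by positivity)
          (Finset.mem_univ i)

lemma norm_ntr_sq_le (hN : N ≠ 0) (X : Matrix (Fin N) (Fin N) ℂ) :
    ‖ntr X‖ ^ 2 ≤ ‖X‖ ^ 2 / N := by
  have hN' : (0 : ℝ) < N := by positivity
  have h := norm_trace_sq_le X
  rw [ntr, norm_mul, norm_inv, Complex.norm_natCast, mul_pow, inv_pow,
    inv_mul_le_iff₀ (by positivity)]
  calc ‖X.trace‖ ^ 2 ≤ N * ‖X‖ ^ 2 := h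
    _ = N ^ 2 * (‖X‖ ^ 2 / N) := by field_simp

lemma opNorm_nonneg (P : Matrix (Fin N) (Fin N) ℂ) : 0 ≤ opNorm P := norm_nonneg _

lemma opNorm_add_le (P Q : Matrix (Fin N) (Fin N) ℂ) : opNorm (P + Q) ≤ opNorm P + opNorm Q := by
  simpa [opNorm] using norm_add_le (Matrix.toEuclideanCLM (n := Fin N) (𝕜 := ℂ) P) _

lemma opNorm_sub_le (P Q : Matrix (Fin N) (Fin N) ℂ) : opNorm (P - Q) ≤ opNorm P + opNorm Q := by
  simpa [opNorm] using norm_sub_le (Matrix.toEuclideanCLM (n := Fin N) (𝕜 := ℂ) P) _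

lemma opNorm_smul (a : ℂ) (P : Matrix (Fin N) (Fin N) ℂ) : opNorm (a • P) = ‖a‖ * opNorm P := by
  simp [opNorm, norm_smul]

lemma opNorm_one_le : opNorm (1 : Matrix (Fin N) (Fin N) ℂ) ≤ 1 := by
  rw [opNorm, map_one]
  exact ContinuousLinearMap.norm_id_le

lemma opNorm_conjTranspose (P : Matrix (Fin N) (Fin N) ℂ) :
    opNorm P.conjTranspose = opNorm P := by
  rw [opNorm, opNorm, ← Matrix.star_eq_conjTranspose, map_star, ContinuousLinearMap.star_eq_adjoint,
    LinearIsometryEquiv.norm_map]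

lemma frobenius_norm_mul_le_opNorm_mul (P X : Matrix (Fin N) (Fin N) ℂ) :
    ‖P * X‖ ≤ opNorm P * ‖X‖ := by
  refine le_of_sq_le_sq ?_ (mul_nonneg (opNorm_nonneg P) (norm_nonneg X))
  -- Column by column: `P` acts on each column of `X` as on a Euclidean vector.
  rw [mul_pow, frobenius_norm_sq_eq_sum, frobenius_norm_sq_eq_sum, Finset.sum_comm,
    Finset.sum_comm (f := fun i j => ‖X i j‖ ^ 2), Finset.mul_sum]
  refine Finset.sum_le_sum fun j _ => ?_
  have h := (Matrix.toEuclideanCLM (n := Fin N) (𝕜 := ℂ) P).le_opNorm (WithLp.toLp 2 fun i => X i j)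
  have h2 := pow_le_pow_left₀ (norm_nonneg _) h 2
  rw [mul_pow, EuclideanSpace.norm_sq_eq, EuclideanSpace.norm_sq_eq] at h2
  exact h2

lemma frobenius_norm_mul_le_mul_opNorm (X P : Matrix (Fin N) (Fin N) ℂ) :
    ‖X * P‖ ≤ ‖X‖ * opNorm P := by
  have h := frobenius_norm_mul_le_opNorm_mul P.conjTranspose X.conjTranspose
  rwa [← Matrix.conjTranspose_mul, Matrix.frobenius_norm_conjTranspose,
    Matrix.frobenius_norm_conjTranspose, opNorm_conjTranspose, mul_comm] at h

end Frobenius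

/-! ### Normalized trace and the stability gap -/

section NormalizedTrace

lemma ntr_sub (X Y : Matrix (Fin N) (Fin N) ℂ) : ntr (X - Y) = ntr X - ntr Y := by
  simp [ntr, mul_sub]

lemma ntr_smul (a : ℂ) (X : Matrix (Fin N) (Fin N) ℂ) : ntr (a • X) = a * ntr X := by
  simp only [ntr, Matrix.trace_smul, smul_eq_mul]
  ring

lemma ntr_conjTranspose (X : Matrix (Fin N) (Fin N) ℂ) :
    ntr X.conjTranspose = star (ntr X) := by
  simp [ntr, Matrix.trace_conjTranspose]

lemma ntr_one (hN : N ≠ 0) : ntr (1 : Matrix (Fin N) (Fin N) ℂ) = 1 := by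
  have : (N : ℂ) ≠ 0 := by exact_mod_cast hN
  simp [ntr, this]

lemma ntr_re (X : Matrix (Fin N) (Fin N) ℂ) : (ntr X).re = X.trace.re / N := by
  rw [ntr, ← Complex.ofReal_natCast, ← Complex.ofReal_inv, Complex.re_ofReal_mul]
  ring

lemma ntr_mul_conjTranspose_self (X : Matrix (Fin N) (Fin N) ℂ) :
    ntr (X * X.conjTranspose) = ((‖X‖ ^ 2 / N : ℝ) : ℂ) := by
  rw [ntr, ← frobenius_norm_sq]
  push_cast
  ring

lemma ntr_imaginaryPart_re (X : Matrix (Fin N) (Fin N) ℂ) :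
    (ntr (ℑ X : Matrix (Fin N) (Fin N) ℂ)).re = (ntr X).im := by
  have h : (ℑ X : Matrix (Fin N) (Fin N) ℂ) = (-Complex.I / 2) • (X - X.conjTranspose) := by
    rw [imaginaryPart_apply_coe, Matrix.star_eq_conjTranspose, ← Complex.coe_smul, smul_smul]
    congr 1
    push_cast
    ring
  rw [h, ntr_smul, ntr_sub, ntr_conjTranspose]
  simp [Complex.mul_re]
  ring

lemma continuous_ntr : Continuous (ntr : Matrix (Fin N) (Fin N) ℂ → ℂ) :=
  continuous_const.mul continuous_id.matrix_trace

lemma frobenius_norm_sub_sq_div (X Y : Matrix (Fin N) (Fin N) ℂ) :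
    ‖X - Y‖ ^ 2 / N = ‖X‖ ^ 2 / N + ‖Y‖ ^ 2 / N - 2 * (ntr (X * Y.conjTranspose)).re := by
  rw [frobenius_norm_sub_sq, ntr_re]
  ring

/-- A contractive pair in the normalized Hilbert-Schmidt norm is separated from the locus
`⟨X Yᴴ⟩ = 1` by half of its squared distance. -/
lemma half_frobenius_norm_sub_sq_le (X Y : Matrix (Fin N) (Fin N) ℂ)
    (hX : ‖X‖ ^ 2 / N ≤ 1) (hY : ‖Y‖ ^ 2 / N ≤ 1) :
    ‖X - Y‖ ^ 2 / N / 2 ≤ ‖1 - ntr (X * Y.conjTranspose)‖ := by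
  have h1 := frobenius_norm_sub_sq_div X Y
  have h2 := Complex.re_le_norm (1 - ntr (X * Y.conjTranspose))
  rw [Complex.sub_re, Complex.one_re] at h2
  linarith

/-- The stability gap of `1 - ⟨X Y⟩` when both normalized traces lie well inside the upper
half-plane. -/
lemma two_mul_sq_le_norm_one_sub_ntr_mul (hN : N ≠ 0) {a : ℝ} (ha : 0 ≤ a)
    (X Y : Matrix (Fin N) (Fin N) ℂ) (hX : ‖X‖ ^ 2 / N ≤ 1) (hY : ‖Y‖ ^ 2 / N ≤ 1)
    (hXa : a ≤ (ntr X).im) (hYa : a ≤ (ntr Y).im) :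
    2 * a ^ 2 ≤ ‖1 - ntr (X * Y)‖ := by
  have h1 := half_frobenius_norm_sub_sq_le X Y.conjTranspose hX
    (by rwa [Matrix.frobenius_norm_conjTranspose])
  rw [Matrix.conjTranspose_conjTranspose] at h1
  have h2 := norm_ntr_sq_le hN (X - Y.conjTranspose)
  have h3 : 2 * a ≤ ‖ntr (X - Y.conjTranspose)‖ := by
    refine le_trans ?_ ((le_abs_self _).trans (Complex.abs_im_le_norm _))
    rw [ntr_sub, ntr_conjTranspose, Complex.sub_im, Complex.star_def, Complex.conj_im]
    linarith
  have h4 := pow_le_pow_left₀ (by linarith) h3 2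
  nlinarith

end NormalizedTrace

/-! ### Resolvent identities and Lipschitz dependence on `η` -/

section Resolvent

/-- `⟨Im M⟩ = Im ω ⟨M Mᴴ⟩` for the resolvent `M = (H - ω)⁻¹` of a Hermitian matrix. -/
lemma im_ntr_resolvent {H M : Matrix (Fin N) (Fin N) ℂ} {ω : ℂ} (hH : H.IsHermitian)
    (hM : M * (H - ω • 1) = 1) : (ntr M).im = ω.im * (‖M‖ ^ 2 / N) := by
  have hM' : (H - star ω • 1) * M.conjTranspose = 1 := by
    have := congrArg Matrix.conjTranspose hM
    simpa [Matrix.conjTranspose_mul, hH.eq] using this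
  have h : M - M.conjTranspose = (ω - star ω) • (M * M.conjTranspose) := by
    calc M - M.conjTranspose
        = M * ((H - star ω • 1) * M.conjTranspose)
            - (M * (H - ω • 1)) * M.conjTranspose := by rw [hM', hM, mul_one, one_mul]
      _ = (ω - star ω) • (M * M.conjTranspose) := by
        simp only [sub_mul, mul_sub, sub_smul, smul_mul_assoc, mul_smul_comm, one_mul, mul_one,
          Matrix.mul_assoc]
        abel
  have h2 := congrArg Complex.im (congrArg ntr h)
  rw [ntr_sub, ntr_conjTranspose, ntr_smul, ntr_mul_conjTranspose_self, Complex.im_mul_ofReal]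
    at h2
  simp only [Complex.sub_im, Complex.star_def, Complex.conj_im] at h2
  linarith

lemma resolvent_sub {W₁ W₂ M₁ M₂ : Matrix (Fin N) (Fin N) ℂ} (h₁ : M₁ * W₁ = 1)
    (h₂ : M₂ * W₂ = 1) : M₁ - M₂ = M₁ * (W₂ - W₁) * M₂ := by
  rw [mul_sub, h₁, sub_mul, one_mul, mul_assoc, mul_eq_one_comm.mp h₂, mul_one]

lemma IsSolution.resolvent {B A M : Matrix (Fin N) (Fin N) ℂ} {x : ℝ} {z : ℂ}
    (h : IsSolution B A x z M) : M * (B + (x : ℂ) • A - (z + ntr M) • 1) = 1 := by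
  obtain ⟨hu, he, -⟩ := h
  have hW : B + (x : ℂ) • A - (z + ntr M) • 1 = M⁻¹ := by
    rw [← neg_neg M⁻¹, he, add_smul]
    abel
  rw [hW, Matrix.mul_nonsing_inv _ ((Matrix.isUnit_iff_isUnit_det _).mp hu)]

lemma isHermitian_add_smul {B A : Matrix (Fin N) (Fin N) ℂ} (hB : B.IsHermitian)
    (hA : A.IsHermitian) (x : ℝ) : (B + (x : ℂ) • A).IsHermitian := by
  refine hB.add ?_
  rw [Matrix.IsHermitian, Matrix.conjTranspose_smul, hA.eq]
  simp

/-- The resolvents at `E + iη + ⟨M⟩` depend Lipschitz-continuously on `η`, as long as `⟨Im M⟩`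
is bounded from below. -/
lemma norm_resolvent_sub_le (hN : N ≠ 0) {a E η₁ η₂ : ℝ} (ha : 0 < a)
    {H M₁ M₂ : Matrix (Fin N) (Fin N) ℂ}
    (h₁ : M₁ * (H - ((E : ℂ) + (η₁ : ℂ) * Complex.I + ntr M₁) • 1) = 1)
    (h₂ : M₂ * (H - ((E : ℂ) + (η₂ : ℂ) * Complex.I + ntr M₂) • 1) = 1)
    (hn₁ : ‖M₁‖ ^ 2 / N ≤ 1) (hn₂ : ‖M₂‖ ^ 2 / N ≤ 1)
    (ha₁ : a ≤ (ntr M₁).im) (ha₂ : a ≤ (ntr M₂).im) :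
    ‖M₁ - M₂‖ ≤ N / (2 * a ^ 2) * |η₁ - η₂| := by
  have hN' : (0 : ℝ) < N := by positivity
  set ω₁ := (E : ℂ) + (η₁ : ℂ) * Complex.I + ntr M₁ with hω₁
  set ω₂ := (E : ℂ) + (η₂ : ℂ) * Complex.I + ntr M₂ with hω₂
  have hd : M₁ - M₂ = (ω₁ - ω₂) • (M₁ * M₂) := by
    rw [resolvent_sub h₁ h₂, sub_sub_sub_cancel_left, ← sub_smul, mul_smul_comm, mul_one,
      smul_mul_assoc]
  have hgap := two_mul_sq_le_norm_one_sub_ntr_mul hN ha.le M₁ M₂ hn₁ hn₂ ha₁ ha₂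
  -- The trace of `hd` gives `⟨M₁⟩ - ⟨M₂⟩ = (ω₁ - ω₂)⟨M₁ M₂⟩`; what remains of `ω₁ - ω₂` is `i(η₁ -
  -- η₂)`.
  have hω : (ω₁ - ω₂) * (1 - ntr (M₁ * M₂)) = ((η₁ - η₂ : ℝ) : ℂ) * Complex.I := by
    have := congrArg ntr hd
    rw [ntr_sub, ntr_smul] at this
    rw [mul_sub, ← this, hω₁, hω₂]
    push_cast
    ring
  have hω' : ‖ω₁ - ω₂‖ ≤ |η₁ - η₂| / (2 * a ^ 2) := by
    rw [le_div_iff₀ (by positivity)]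
    calc ‖ω₁ - ω₂‖ * (2 * a ^ 2) ≤ ‖ω₁ - ω₂‖ * ‖1 - ntr (M₁ * M₂)‖ := by gcongr
      _ = |η₁ - η₂| := by 
          rw [← norm_mul, hω, norm_mul, Complex.norm_I, mul_one, Complex.norm_real,
            Real.norm_eq_abs]
  have hM : ‖M₁ * M₂‖ ≤ N := by
    rw [div_le_one hN'] at hn₁ hn₂
    refine (Matrix.frobenius_norm_mul _ _).trans ?_
    nlinarith [sq_nonneg (‖M₁‖ - ‖M₂‖)]
  rw [hd, norm_smul]
  calc ‖ω₁ - ω₂‖ * ‖M₁ * M₂‖ ≤ |η₁ - η₂| / (2 * a ^ 2) * N := by gcongr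
    _ = N / (2 * a ^ 2) * |η₁ - η₂| := by ring

end Resolvent

/-! ### Boundary values in the bulk -/

section Boundary

lemma exists_tendsto_of_norm_sub_le {F : Type*} [NormedAddCommGroup F] [CompleteSpace F]
    {f : ℝ → F} {s : Set ℝ} {K : ℝ} (hs : s ∈ 𝓝[>] (0 : ℝ))
    (hf : ∀ u ∈ s, ∀ v ∈ s, ‖f u - f v‖ ≤ K * |u - v|) :
    ∃ y, Tendsto f (𝓝[>] (0 : ℝ)) (𝓝 y) := by
  rw [← cauchy_map_iff_exists_tendsto]
  have hl : LipschitzOnWith K.toNNReal f s := by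
    refine LipschitzOnWith.of_dist_le_mul fun u hu v hv => ?_
    rw [dist_eq_norm, Real.dist_eq]
    exact (hf u hu v hv).trans
      (mul_le_mul_of_nonneg_right (Real.le_coe_toNNReal K) (abs_nonneg _))
  exact (cauchy_nhds.mono nhdsWithin_le_nhds).map_of_le hl.uniformContinuousOn
    (le_principal_iff.mpr hs)

lemma isSolution_sol_of_ne_zero {B A : Matrix (Fin N) (Fin N) ℂ} {x : ℝ} {z : ℂ}
    (h : sol B A x z ≠ 0) : IsSolution B A x z (sol B A x z) := by
  unfold sol at h ⊢
  split_ifs with hs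
  · exact hs.choose_spec
  · simp [hs] at h

lemma smoothedDensity_eq (B A : Matrix (Fin N) (Fin N) ℂ) (x E η : ℝ) :
    smoothedDensity B A x E η =
      Real.pi⁻¹ * (ntr (sol B A x ((E : ℂ) + (η : ℂ) * Complex.I))).im := by
  rw [smoothedDensity, ntr_imaginaryPart_re]

variable {c : ℝ} {B A : Matrix (Fin N) (Fin N) ℂ} {x E : ℝ}

lemma IsBulk.ne_zero (hc : 0 < c) (h : IsBulk c B A x E) : N ≠ 0 := by
  rintro rfl
  obtain ⟨ht, hle⟩ := h
  have h0 : smoothedDensity B A x E = fun _ => 0 := by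
    funext η
    simp [smoothedDensity, ntr]
  rw [h0] at ht
  have := tendsto_nhds_unique ht tendsto_const_nhds
  linarith

/-- A positive density rules out the default value `0` of `sol`, so existence of solutions near the
axis needs no separate proof. -/
lemma IsBulk.eventually (hc : 0 < c) (h : IsBulk c B A x E) :
    ∀ᶠ η : ℝ in 𝓝[>] (0 : ℝ), 0 < η ∧
      IsSolution B A x ((E : ℂ) + (η : ℂ) * Complex.I)
        (sol B A x ((E : ℂ) + (η : ℂ) * Complex.I)) ∧
      c / 2 ≤ (ntr (sol B A x ((E : ℂ) + (η : ℂ) * Complex.I))).im := by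
  filter_upwards [h.1.eventually (lt_mem_nhds (show c / 2 < scDos B A x E by linarith [h.2])),
    self_mem_nhdsWithin] with η hη hpos
  have him : c / 2 ≤ (ntr (sol B A x ((E : ℂ) + (η : ℂ) * Complex.I))).im := by
    rw [smoothedDensity_eq, lt_inv_mul_iff₀ Real.pi_pos] at hη
    nlinarith [Real.pi_gt_three]
  refine ⟨hpos, isSolution_sol_of_ne_zero fun h0 => ?_, him⟩
  rw [h0] at him
  simp [ntr] at him
  linarith

/-- The resolvent identity reads `Im ⟨M⟩ = (η + Im ⟨M⟩) ‖M‖²/N` with `η ≥ 0`. -/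
lemma norm_sq_div_le_one_of_isSolution {M : Matrix (Fin N) (Fin N) ℂ} {η : ℝ}
    (hB : B.IsHermitian) (hA : A.IsHermitian) (hη : 0 ≤ η)
    (hM : IsSolution B A x ((E : ℂ) + (η : ℂ) * Complex.I) M) (hpos : 0 < (ntr M).im) :
    ‖M‖ ^ 2 / N ≤ 1 := by
  have h := im_ntr_resolvent (isHermitian_add_smul hB hA x) hM.resolvent
  simp only [Complex.add_im, Complex.ofReal_im, Complex.mul_im, Complex.ofReal_re, Complex.I_im,
    Complex.I_re, mul_one, mul_zero, zero_add, add_zero] at h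
  by_contra! hlt
  nlinarith

lemma IsBulk.hasBdry (hc : 0 < c) (hB : B.IsHermitian) (hA : A.IsHermitian)
    (h : IsBulk c B A x E) : HasBdry B A x E := by
  refine tendsto_nhds_limUnder ?_
  -- A Lipschitz constant depending on `N` is harmless: only existence of the limit is extracted.
  refine exists_tendsto_of_norm_sub_le (K := N / (2 * (c / 2) ^ 2)) (h.eventually hc) ?_
  rintro u ⟨hu, hus, hui⟩ v ⟨hv, hvs, hvi⟩
  exact norm_resolvent_sub_le (h.ne_zero hc) (by positivity) hus.resolvent hvs.resolvent
    (norm_sq_div_le_one_of_isSolution hB hA hu.le hus (by linarith))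
    (norm_sq_div_le_one_of_isSolution hB hA hv.le hvs (by linarith)) hui hvi

lemma IsBulk.le_im_ntr_bdry (hc : 0 < c) (hB : B.IsHermitian) (hA : A.IsHermitian)
    (h : IsBulk c B A x E) : Real.pi * c ≤ (ntr (bdry B A x E)).im := by
  have h1 := (Complex.continuous_im.comp continuous_ntr).continuousAt.tendsto.comp
    (h.hasBdry hc hB hA)
  have h2 : Tendsto (smoothedDensity B A x E) (𝓝[>] (0 : ℝ))
      (𝓝 (Real.pi⁻¹ * (ntr (bdry B A x E)).im)) := by
    simp only [funext (smoothedDensity_eq B A x E)]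
    exact h1.const_mul _
  have h3 := h.2
  rw [tendsto_nhds_unique h.1 h2] at h3
  rwa [le_inv_mul_iff₀ Real.pi_pos] at h3

lemma IsBulk.resolvent_bdry (hc : 0 < c) (hB : B.IsHermitian) (hA : A.IsHermitian)
    (h : IsBulk c B A x E) :
    bdry B A x E * (B + (x : ℂ) • A - ((E : ℂ) + ntr (bdry B A x E)) • 1) = 1 := by
  have hb : Tendsto (fun η : ℝ => sol B A x ((E : ℂ) + (η : ℂ) * Complex.I)) (𝓝[>] (0 : ℝ))
    (𝓝 (bdry B A x E)) := h.hasBdry hc hB hA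
  have hη : Tendsto (fun η : ℝ => (E : ℂ) + (η : ℂ) * Complex.I) (𝓝[>] (0 : ℝ)) (𝓝 (E : ℂ)) := by
    have : Continuous fun η : ℝ => (E : ℂ) + (η : ℂ) * Complex.I := by fun_prop
    simpa using (this.tendsto 0).mono_left nhdsWithin_le_nhds
  have hm := (continuous_ntr.tendsto _).comp hb
  have hlim := hb.mul (tendsto_const_nhds (x := B + (x : ℂ) • A) |>.sub
    ((hη.add hm).smul_const (1 : Matrix (Fin N) (Fin N) ℂ)))
  refine tendsto_nhds_unique hlim (tendsto_const_nhds.congr' ?_)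
  filter_upwards [h.eventually hc] with η hs
  exact hs.2.1.resolvent.symm

lemma IsBulk.norm_sq_bdry (hc : 0 < c) (hB : B.IsHermitian) (hA : A.IsHermitian)
    (h : IsBulk c B A x E) : ‖bdry B A x E‖ ^ 2 / N = 1 := by
  have h1 := im_ntr_resolvent (isHermitian_add_smul hB hA x) (h.resolvent_bdry hc hB hA)
  have h2 : 0 < (ntr (bdry B A x E)).im :=
    (mul_pos Real.pi_pos hc).trans_le (h.le_im_ntr_bdry hc hB hA)
  rw [Complex.add_im, Complex.ofReal_im, zero_add] at h1
  exact (mul_eq_left₀ h2.ne').mp h1.symm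

/-- No a priori bound on `E` is required: `ω M = M H - 1` and `‖M‖ = ‖1‖` force `|ω| ≤ opNorm H +
1`. -/
lemma opNorm_resolvent_inv_le (hN : N ≠ 0) {H M : Matrix (Fin N) (Fin N) ℂ} {ω : ℂ}
    (hM : M * (H - ω • 1) = 1) (hn : ‖M‖ ^ 2 / N = 1) :
    opNorm (H - ω • 1) ≤ 2 * opNorm H + 1 := by
  have hN' : (0 : ℝ) < N := by positivity
  have hM1 : ‖M‖ = ‖(1 : Matrix (Fin N) (Fin N) ℂ)‖ := by
    rw [← sq_eq_sq₀ (norm_nonneg _) (norm_nonneg _), frobenius_norm_one_sq]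
    field_simp at hn
    exact hn
  have hpos : 0 < ‖M‖ := by
    refine (norm_nonneg M).lt_of_ne fun h0 => ?_
    simp [← h0] at hn
  have hω : ‖ω‖ ≤ opNorm H + 1 := by
    have he : ω • M = M * H - 1 := by
      rw [← hM, mul_sub, mul_smul_comm, mul_one]
      abel
    have h1 : ‖ω‖ * ‖M‖ ≤ (opNorm H + 1) * ‖M‖ := by
      rw [← norm_smul, he]
      refine (norm_sub_le _ _).trans ?_
      rw [← hM1]
      linarith [frobenius_norm_mul_le_mul_opNorm M H]
    exact le_of_mul_le_mul_right h1 hpos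
  refine (opNorm_sub_le _ _).trans ?_
  rw [opNorm_smul]
  nlinarith [opNorm_one_le (N := N), norm_nonneg ω, opNorm_nonneg H]

end Boundary

/-! ### Upper bounds for the main term -/

section MainTerm

lemma ntr_traceless (hN : N ≠ 0) (A : Matrix (Fin N) (Fin N) ℂ) : ntr (traceless A) = 0 := by
  rw [traceless, ntr_sub, ntr_smul, ntr_one hN, mul_one, sub_self]

lemma star_ntr_of_isHermitian {A : Matrix (Fin N) (Fin N) ℂ} (hA : A.IsHermitian) :
    star (ntr A) = ntr A := by
  rw [← ntr_conjTranspose, hA.eq]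

lemma ntr_traceless_sq {A : Matrix (Fin N) (Fin N) ℂ} (hA : A.IsHermitian) :
    (ntr (traceless A ^ 2)).re = ‖traceless A‖ ^ 2 / N := by
  have h : (traceless A).conjTranspose = traceless A := by
    rw [traceless, Matrix.conjTranspose_sub, hA.eq, Matrix.conjTranspose_smul,
      star_ntr_of_isHermitian hA, Matrix.conjTranspose_one]
  have h2 := ntr_mul_conjTranspose_self (traceless A)
  rw [h, ← sq] at h2
  rw [h2, Complex.ofReal_re]

/-- Pythagoras for the decomposition of `a • A - b` into traceless and scalar part. -/
lemma frobenius_norm_sq_smul_sub_smul_one (hN : N ≠ 0) (a b : ℂ)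
    (A : Matrix (Fin N) (Fin N) ℂ) :
    ‖a • A - b • (1 : Matrix (Fin N) (Fin N) ℂ)‖ ^ 2 / N =
      ‖a‖ ^ 2 * (‖traceless A‖ ^ 2 / N) + ‖b - a * ntr A‖ ^ 2 := by
  have hN' : (0 : ℝ) < N := by positivity
  have h : a • A - b • (1 : Matrix (Fin N) (Fin N) ℂ) =
      a • traceless A - (b - a * ntr A) • (1 : Matrix (Fin N) (Fin N) ℂ) := by
    rw [traceless, smul_sub, sub_smul, smul_smul]
    abel
  rw [h, frobenius_norm_sub_sq_div, Matrix.conjTranspose_smul, Matrix.conjTranspose_one,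
    smul_mul_assoc, mul_smul_comm, mul_one, ntr_smul, ntr_smul, ntr_traceless hN, norm_smul,
    norm_smul, mul_pow, mul_pow, frobenius_norm_one_sq]
  field_simp
  simp

lemma mainTerm_le_of_opNorm_le (hN : N ≠ 0) {A : Matrix (Fin N) (Fin N) ℂ} (hA : A.IsHermitian)
    {x₁ x₂ E₁ E₂ K : ℝ} (hK : opNorm A ≤ K) (h : |x₁ - x₂| + |E₁ - E₂| ≤ 1) :
    mainTerm A x₁ x₂ E₁ E₂ ≤ 2 + 2 * K ^ 2 := by
  have hN' : (0 : ℝ) < N := by positivity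
  have hK0 := opNorm_nonneg A
  have hX := frobenius_norm_sq_smul_sub_smul_one hN ((x₁ - x₂ : ℝ) : ℂ) ((E₁ - E₂ : ℝ) : ℂ) A
  -- By Pythagoras the main term is itself a normalized squared Frobenius norm.
  have hm : mainTerm A x₁ x₂ E₁ E₂ =
      ‖((x₁ - x₂ : ℝ) : ℂ) • A - ((E₁ - E₂ : ℝ) : ℂ) • (1 : Matrix (Fin N) (Fin N) ℂ)‖ ^ 2
        / N := by
    rw [hX, mainTerm, ntr_traceless_sq hA, Complex.norm_real, Real.norm_eq_abs, add_comm]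
    congr 3
    push_cast
    ring
  have h1 : ‖((x₁ - x₂ : ℝ) : ℂ) • A - ((E₁ - E₂ : ℝ) : ℂ) • (1 : Matrix (Fin N) (Fin N) ℂ)‖ ≤
      (K + 1) * ‖(1 : Matrix (Fin N) (Fin N) ℂ)‖ := by
    have hA1 := frobenius_norm_mul_le_opNorm_mul A 1
    rw [mul_one] at hA1
    have h1 := norm_nonneg (1 : Matrix (Fin N) (Fin N) ℂ)
    refine (norm_sub_le _ _).trans ?_
    rw [norm_smul, norm_smul, Complex.norm_real, Complex.norm_real, Real.norm_eq_abs,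
      Real.norm_eq_abs]
    have ha : |x₁ - x₂| * ‖A‖ ≤ 1 * (K * ‖(1 : Matrix (Fin N) (Fin N) ℂ)‖) := by
      gcongr
      · linarith [abs_nonneg (E₁ - E₂)]
      · exact hA1.trans (by gcongr)
    have hb : |E₁ - E₂| * ‖(1 : Matrix (Fin N) (Fin N) ℂ)‖ ≤
        1 * ‖(1 : Matrix (Fin N) (Fin N) ℂ)‖ := by
      gcongr
      linarith [abs_nonneg (x₁ - x₂)]
    linarith
  have h2 := pow_le_pow_left₀ (norm_nonneg _) h1 2
  rw [mul_pow, frobenius_norm_one_sq, ← div_le_iff₀ hN'] at h2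
  rw [hm]
  nlinarith [sq_nonneg (K - 1)]

/-- Two resolvents at `ω_r = E_r + ⟨M_r⟩` are at least as far apart as the underlying
parameters. -/
lemma mainTerm_le_norm_resolvent_sub_sq (hN : N ≠ 0) {A B M₁ M₂ : Matrix (Fin N) (Fin N) ℂ}
    (hA : A.IsHermitian) {x₁ x₂ E₁ E₂ κ : ℝ} (hκ : 1 ≤ κ)
    (h₁ : M₁ * (B + (x₁ : ℂ) • A - ((E₁ : ℂ) + ntr M₁) • 1) = 1)
    (h₂ : M₂ * (B + (x₂ : ℂ) • A - ((E₂ : ℂ) + ntr M₂) • 1) = 1)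
    (hκ₁ : opNorm (B + (x₁ : ℂ) • A - ((E₁ : ℂ) + ntr M₁) • 1) ≤ κ)
    (hκ₂ : opNorm (B + (x₂ : ℂ) • A - ((E₂ : ℂ) + ntr M₂) • 1) ≤ κ) :
    mainTerm A x₁ x₂ E₁ E₂ ≤ 4 * κ ^ 4 * (‖M₁ - M₂‖ ^ 2 / N) := by
  set W₁ := B + (x₁ : ℂ) • A - ((E₁ : ℂ) + ntr M₁) • (1 : Matrix (Fin N) (Fin N) ℂ) with hW₁
  set W₂ := B + (x₂ : ℂ) • A - ((E₂ : ℂ) + ntr M₂) • (1 : Matrix (Fin N) (Fin N) ℂ) with hW₂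
  have hN' : (0 : ℝ) < N := by positivity
  have hκ0 : 0 ≤ κ := by linarith
  set a : ℂ := (x₁ : ℂ) - x₂ with ha
  set b : ℂ := (E₁ : ℂ) + ntr M₁ - (E₂ + ntr M₂) with hb
  have hWd : W₁ - W₂ = a • A - b • (1 : Matrix (Fin N) (Fin N) ℂ) := by
    rw [hW₁, hW₂, ha, hb, sub_smul, sub_smul]
    abel
  have hWle : ‖W₁ - W₂‖ ≤ κ ^ 2 * ‖M₁ - M₂‖ := by
    -- The resolvent identity with the roles of `M` and its inverse `W` exchanged.
    have he : W₁ - W₂ = W₁ * (M₂ - M₁) * W₂ :=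
      resolvent_sub (mul_eq_one_comm.mp h₁) (mul_eq_one_comm.mp h₂)
    rw [he, norm_sub_rev M₁]
    calc ‖W₁ * (M₂ - M₁) * W₂‖ ≤ ‖W₁ * (M₂ - M₁)‖ * opNorm W₂ :=
          frobenius_norm_mul_le_mul_opNorm _ _
      _ ≤ opNorm W₁ * ‖M₂ - M₁‖ * opNorm W₂ := by
          gcongr
          · exact opNorm_nonneg _
          · exact frobenius_norm_mul_le_opNorm_mul _ _
      _ ≤ κ * ‖M₂ - M₁‖ * κ := by
          gcongr
          exact opNorm_nonneg _
      _ = κ ^ 2 * ‖M₂ - M₁‖ := by ring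
  have hW2 : ‖W₁ - W₂‖ ^ 2 / N ≤ κ ^ 4 * (‖M₁ - M₂‖ ^ 2 / N) := by
    rw [← mul_div_assoc]
    gcongr
    calc ‖W₁ - W₂‖ ^ 2 ≤ (κ ^ 2 * ‖M₁ - M₂‖) ^ 2 := by gcongr
      _ = κ ^ 4 * ‖M₁ - M₂‖ ^ 2 := by ring
  rw [hWd, frobenius_norm_sq_smul_sub_smul_one hN] at hW2
  have hm := norm_ntr_sq_le hN (M₁ - M₂)
  rw [ntr_sub] at hm
  have hE : ‖(E₁ : ℂ) - x₁ * ntr A - E₂ + x₂ * ntr A‖ ^ 2 ≤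
      2 * ‖b - a * ntr A‖ ^ 2 + 2 * ‖ntr M₁ - ntr M₂‖ ^ 2 := by
    have he : (E₁ : ℂ) - x₁ * ntr A - E₂ + x₂ * ntr A =
        (b - a * ntr A) - (ntr M₁ - ntr M₂) := by
      rw [ha, hb]
      ring
    have h1 := pow_le_pow_left₀ (norm_nonneg _)
      (norm_sub_le (b - a * ntr A) (ntr M₁ - ntr M₂)) 2
    rw [he]
    nlinarith [sq_nonneg (‖b - a * ntr A‖ - ‖ntr M₁ - ntr M₂‖)]
  have hanorm : ‖a‖ = |x₁ - x₂| := by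
    rw [ha, ← Complex.ofReal_sub, Complex.norm_real, Real.norm_eq_abs]
  rw [mainTerm, ntr_traceless_sq hA, ← hanorm]
  have hT : 0 ≤ ‖a‖ ^ 2 * (‖traceless A‖ ^ 2 / N) := by positivity
  have hD : 0 ≤ ‖M₁ - M₂‖ ^ 2 / N := by positivity
  have hκ4 : 1 ≤ κ ^ 4 := one_le_pow₀ hκ
  -- The factor 4 comes from `2κ⁴ + 2 ≤ 4κ⁴`; the summand 2 pays for `⟨M₁⟩ - ⟨M₂⟩`.
  nlinarith

end MainTerm

end MDE

theorem lemma4p3 :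
    ∀ c₁ : ℝ, 0 < c₁ → ∃ cstar : ℝ, 0 < cstar ∧
      ∀ C₀ C_A L : ℝ, ∃ c C : ℝ, 0 < c ∧ 0 < C ∧
        ∀ (N : ℕ) (B A : Matrix (Fin N) (Fin N) ℂ),
          B.IsHermitian → A.IsHermitian → MDE.opNorm B ≤ C₀ → MDE.opNorm A ≤ C_A →
          ∀ x₁ x₂ E₁ E₂ : ℝ,
            |x₁| ≤ L → |x₂| ≤ L →
            |x₁ - x₂| + |E₁ - E₂| ≤ cstar →
            MDE.IsBulk c₁ B A x₁ E₁ → MDE.IsBulk c₁ B A x₂ E₂ →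
            MDE.HasBdry B A x₁ E₁ ∧ MDE.HasBdry B A x₂ E₂ ∧
            c * MDE.mainTerm A x₁ x₂ E₁ E₂ - C * (|x₁ - x₂| ^ 3 + |E₁ - E₂| ^ 3) ≤
              ‖1 - MDE.ntr (MDE.bdry B A x₁ E₁ * MDE.bdry B A x₂ E₂)‖ ∧
            c * MDE.mainTerm A x₁ x₂ E₁ E₂ - C * (|x₁ - x₂| ^ 3 + |E₁ - E₂| ^ 3) ≤
              ‖1 - MDE.ntr (MDE.bdry B A x₁ E₁ * (MDE.bdry B A x₂ E₂).conjTranspose)‖ := by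
  intro c₁ hc₁
  -- The radius only serves to bound the main term in the case without adjoint.
  refine ⟨1, one_pos, fun C₀ C_A L => ?_⟩
  set κ : ℝ := 2 * (|C₀| + |L| * |C_A|) + 1 with hκ_def
  have hκ : 1 ≤ κ := by
    have : 0 ≤ |C₀| + |L| * |C_A| := by positivity
    linarith
  have hκ0 : 0 < κ := by linarith
  set a : ℝ := Real.pi * c₁ with ha_def
  have ha : 0 < a := mul_pos Real.pi_pos hc₁
  -- The first entry serves the adjoint case (`8 = 2 · 4`, from the half in the distance identity),
  -- the second is gap over maximal main term.
  set c : ℝ := min (1 / (8 * κ ^ 4)) (2 * a ^ 2 / (2 + 2 * C_A ^ 2)) with hc_def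
  have hc : 0 < c := lt_min (by positivity) (by positivity)
  -- Both bounds hold without the cubic error, so any positive `C` works.
  refine ⟨c, 1, hc, one_pos, fun N B A hB hA hBn hAn x₁ x₂ E₁ E₂ hx₁ hx₂ hd h₁ h₂ => ?_⟩
  have hN := h₁.ne_zero hc₁
  have herr : 0 ≤ 1 * (|x₁ - x₂| ^ 3 + |E₁ - E₂| ^ 3) := by positivity
  have hH : ∀ x : ℝ, |x| ≤ L → 2 * MDE.opNorm (B + (x : ℂ) • A) + 1 ≤ κ := by
    intro x hx
    have h := MDE.opNorm_add_le B ((x : ℂ) • A)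
    rw [MDE.opNorm_smul, Complex.norm_real, Real.norm_eq_abs] at h
    have h' : |x| * MDE.opNorm A ≤ |L| * |C_A| := by
      exact mul_le_mul (hx.trans (le_abs_self L)) (hAn.trans (le_abs_self C_A))
        (MDE.opNorm_nonneg A) (abs_nonneg L)
    linarith [hBn.trans (le_abs_self C₀)]
  have hn₁ := h₁.norm_sq_bdry hc₁ hB hA
  have hn₂ := h₂.norm_sq_bdry hc₁ hB hA
  have hr₁ := h₁.resolvent_bdry hc₁ hB hA
  have hr₂ := h₂.resolvent_bdry hc₁ hB hA
  refine ⟨h₁.hasBdry hc₁ hB hA, h₂.hasBdry hc₁ hB hA, ?_, ?_⟩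
  · have hgap := MDE.two_mul_sq_le_norm_one_sub_ntr_mul hN ha.le _ _ hn₁.le hn₂.le
      (h₁.le_im_ntr_bdry hc₁ hB hA) (h₂.le_im_ntr_bdry hc₁ hB hA)
    have hm := MDE.mainTerm_le_of_opNorm_le hN hA hAn hd
    have hc2 : c * (2 + 2 * C_A ^ 2) ≤ 2 * a ^ 2 := by
      rw [← le_div_iff₀ (by positivity)]
      exact min_le_right _ _
    have := mul_le_mul_of_nonneg_left hm hc.le
    linarith
  · have hgap := MDE.half_frobenius_norm_sub_sq_le _ _ hn₁.le hn₂.le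
    have hm := MDE.mainTerm_le_norm_resolvent_sub_sq hN hA hκ hr₁ hr₂
      ((MDE.opNorm_resolvent_inv_le hN hr₁ hn₁).trans (hH x₁ hx₁))
      ((MDE.opNorm_resolvent_inv_le hN hr₂ hn₂).trans (hH x₂ hx₂))
    have hc1 : c * (8 * κ ^ 4) ≤ 1 := by
      rw [← le_div_iff₀ (by positivity)]
      exact min_le_left _ _
    set D := ‖MDE.bdry B A x₁ E₁ - MDE.bdry B A x₂ E₂‖ ^ 2 / N with hD_def
    have hD : 0 ≤ D := by positivity
    have := mul_le_mul_of_nonneg_left hm hc.le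
    have := mul_le_mul_of_nonneg_right hc1 hD
    linarith
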